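/- For a finite group $K$ let $\mathrm{Irr}(K)$ be the set of its irreducible complex characters. For a subgroup $H$ of a finite group $G$, let $M=(m_{\psi\chi})$ be the inclusion matrix of $\mathbb{C}[H]\subseteq\mathbb{C}[G]$, with rows indexed by $\psi\in\mathrm{Irr}(H)$, columns by $\chi\in\mathrm{Irr}(G)$, and $m_{\psi\chi}=\langle \psi,\chi|_H\rangle_H$ the multiplicity of $\psi$ in the restriction of $\chi$ to $H$. Put $M^{2k}:=(MM^t)^k$ and $M^{2k+1}:=(MM^t)^kM$ for $k\ge 0$ (so $M^0$ is the identity matrix). The depth of $H$ in $G$ is the least integer $n\ge 1$ such that $M^{n+1}\le q\,M^{n-1}$ entrywise for some positive integer $q$. **Theorem.** Let $H$ be a subgroup of a finite group $G$, let $m\ge 1$, and suppose that the core $N:=\mathrm{core}_G(H)=\bigcap_{x\in G}xHx^{-1}$ is the intersection of $m$ conjugates of $H$, i.e. $N=\bigcap_{i=1}^m x_iHx_i^{-1}$ for some $x_1,\dots,x_m\in G$. Then $H$ has depth $\le 2m$ in $G$. If moreover $N\subseteq Z(G)$, where $Z(G)$ is the center of $G$, then $H$ has depth $\le 2m-1$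 in $G$. -/

import Mathlib

namespace SubgroupDepth

noncomputable section

/-! ### Depth of a matrix of non-negative integers -/

section MatrixDepth

variable {r s : Type*} [Fintype r] [Fintype s] [DecidableEq r]

/-- The power `M ^ (2 * k) = (M * Mᵀ) ^ k` of a rectangular matrix, a square matrix
(so that `M ^ 0` is the identity matrix). -/
def evenPow (M : Matrix r s ℕ) (k : ℕ) : Matrix r r ℕ := (M * M.transpose) ^ k

/-- The power `M ^ (2 * k + 1) = (M * Mᵀ) ^ k * M` of a rectangular matrix. -/
def oddPow (M : Matrix r s ℕ) (k : ℕ) : Matrix r s ℕ := (M * M.transpose) ^ k * M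

/-- The depth `n` matrix inequality: `M ^ (n + 1) ≤ q M ^ (n - 1)` entrywise for some positive
integer `q`. The first alternative is the case of odd `n`, the second one of even `n ≥ 2`;
it never holds for `n = 0`. -/
def DepthInequality (M : Matrix r s ℕ) (n : ℕ) : Prop :=
  (∃ k, n = 2 * k + 1 ∧ ∃ q : ℕ, 0 < q ∧ ∀ i j, evenPow M (k + 1) i j ≤ q * evenPow M k i j) ∨
  (∃ k, n = 2 * k + 2 ∧ ∃ q : ℕ, 0 < q ∧ ∀ i j, oddPow M (k + 1) i j ≤ q * oddPow M k i j)

/-- The depth of a matrix: the least `n ≥ 1` for which the depth `n` inequality holds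
(`⊤` if there were none). -/
def matrixDepth (M : Matrix r s ℕ) : ℕ∞ :=
  ⨅ n : {n : ℕ // DepthInequality M n}, (n.1 : ℕ∞)

end MatrixDepth

/-! ### Irreducible complex characters and the inclusion matrix -/

/-- `Irr G`: the irreducible complex characters of `G`, that is, the characters of its
irreducible representations on the spaces `ℂ ^ n`. -/
def Irr (G : Type*) [Group G] : Type _ :=
  {χ : G → ℂ // ∃ (n : ℕ) (ρ : Representation ℂ G (Fin n → ℂ)),
    ρ.IsIrreducible ∧ ρ.character = χ}

namespace Irr

variable {G : Type*} [Group G]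

/-- The dimension of a representation affording `χ`. -/
def dim (χ : Irr G) : ℕ := χ.2.choose

/-- An irreducible representation affording `χ`. It is unique up to isomorphism
if `G` is finite. -/
def rep (χ : Irr G) : Representation ℂ G (Fin χ.dim → ℂ) := χ.2.choose_spec.choose

theorem rep_isIrreducible (χ : Irr G) : χ.rep.IsIrreducible :=
  χ.2.choose_spec.choose_spec.1

theorem character_rep (χ : Irr G) : χ.rep.character = χ.1 :=
  χ.2.choose_spec.choose_spec.2

theorem sum_mul_eq_zero [Fintype G] {χ ψ : Irr G} (h : χ ≠ ψ) :
    ∑ g : G, χ.1 g * ψ.1 g⁻¹ = 0 := by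
  classical
  have hc : (Nat.card G : ℂ) ≠ 0 := Nat.cast_ne_zero.2 Nat.card_pos.ne'
  let _ : Invertible (Nat.card G : ℂ) := invertibleOfNonzero hc
  have := χ.rep_isIrreducible
  have := ψ.rep_isIrreducible
  have h1 := Representation.char_orthonormal χ.rep ψ.rep
  rw [if_neg, character_rep, character_rep] at h1
  · exact (mul_eq_zero.1 h1).resolve_left (inv_ne_zero hc)
  · rintro ⟨e⟩
    apply h
    apply Subtype.ext
    rw [← character_rep χ, ← character_rep ψ, Representation.char_iso e]

theorem sum_mul_ne_zero [Fintype G] (χ : Irr G) : ∑ g : G, χ.1 g * χ.1 g⁻¹ ≠ 0 := by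
  classical
  have hc : (Nat.card G : ℂ) ≠ 0 := Nat.cast_ne_zero.2 Nat.card_pos.ne'
  let _ : Invertible (Nat.card G : ℂ) := invertibleOfNonzero hc
  have := χ.rep_isIrreducible
  have h1 := Representation.char_orthonormal χ.rep χ.rep
  rw [if_pos ⟨Representation.Equiv.refl _⟩, character_rep] at h1
  intro h0
  rw [h0, mul_zero] at h1
  exact zero_ne_one h1

/-- A finite group has finitely many irreducible characters. -/
instance [Finite G] : Finite (Irr G) := by
  classical
  have := Fintype.ofFinite G
  have hli : LinearIndependent ℂ (fun χ : Irr G => (χ.1 : G → ℂ)) := by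
    rw [linearIndependent_iff']
    intro t c hsum ψ hψ
    have h1 : ∑ χ ∈ t, c χ * ∑ g : G, χ.1 g * ψ.1 g⁻¹ = 0 := by
      have h2 : ∀ g : G, ∑ χ ∈ t, c χ * χ.1 g = 0 := fun g => by
        simpa using congrFun hsum g
      calc ∑ χ ∈ t, c χ * ∑ g : G, χ.1 g * ψ.1 g⁻¹
          = ∑ g : G, (∑ χ ∈ t, c χ * χ.1 g) * ψ.1 g⁻¹ := by
            simp_rw [Finset.mul_sum, Finset.sum_mul, mul_assoc]
            exact Finset.sum_comm
        _ = 0 := by simp [h2]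
    rw [Finset.sum_eq_single_of_mem ψ hψ
      (fun χ _ hne => by rw [sum_mul_eq_zero hne, mul_zero])] at h1
    exact (mul_eq_zero.1 h1).resolve_right (sum_mul_ne_zero ψ)
  exact hli.finite

instance [Finite G] : Fintype (Irr G) := Fintype.ofFinite _

instance : DecidableEq (Irr G) := Classical.decEq _

end Irr

/-- The inclusion matrix (induction-restriction table) of a subgroup `H` of `G`: its entry at
`ψ ∈ Irr H`, `χ ∈ Irr G` is the multiplicity of `ψ` in the restriction of `χ` to `H`, i.e. the
dimension of the space of `H`-homomorphisms from a representation affording `ψ` to the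
restriction of a representation affording `χ`. -/
def inclusionMatrix {G : Type*} [Group G] (H : Subgroup G) : Matrix (Irr H) (Irr G) ℕ :=
  fun ψ χ => Module.finrank ℂ (Representation.IntertwiningMap ψ.rep (χ.rep.comp H.subtype))

/-- The entries of the inclusion matrix are the inner products
`⟨χ|_H, ψ⟩ = |H|⁻¹ ∑ χ(h) ψ(h⁻¹)`; they depend only on the characters. -/
theorem inclusionMatrix_eq {G : Type*} [Group G] (H : Subgroup G) [Fintype H]
    (ψ : Irr H) (χ : Irr G) :
    (inclusionMatrix H ψ χ : ℂ) =
      (Nat.card H : ℂ)⁻¹ * ∑ h : H, χ.1 (h : G) * ψ.1 h⁻¹ := by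
  have hc : (Nat.card H : ℂ) ≠ 0 := Nat.cast_ne_zero.2 Nat.card_pos.ne'
  let _ : Invertible (Nat.card H : ℂ) := invertibleOfNonzero hc
  have h1 := Representation.card_inv_mul_sum_char_mul_char_eq_finrank ψ.rep
    (χ.rep.comp H.subtype)
  rw [inclusionMatrix, ← h1, Irr.character_rep, ← Irr.character_rep χ]
  rfl

/-- The depth of a subgroup `H` of a finite group `G`: the depth of the inclusion matrix. -/
def subgroupDepth {G : Type*} [Group G] [Finite G] (H : Subgroup G) : ℕ∞ :=
  matrixDepth (inclusionMatrix H)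

end

end SubgroupDepth

/-! Whether `A ≤ q * B` holds for some `q` depends only on supports, so it suffices to find the
nonzero entries of the powers of `M`. Restriction followed by induction multiplies a character by
the permutation character `π` of `G` on the cosets of `H`, so the entry of `M ^ (2k+1)` at `(ψ, χ)`
is the inner product over `H` of `ψ` with `χ π ^ k`. As `π ^ k` counts `k`-tuples `t`, up to a
factor, this entry is a positive combination of `dim Hom(ψ, χ)` over the groups `H_t`, the
intersections of `H` with `k` conjugates (`card_pow_mul_oddPow`). Hom spaces grow under restriction
and every `H_t` contains `N`. If some `H_t` equals `N`, the support consists of the pairs with a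
common constituent on `N`, and longer powers cannot exceed it. In even powers `ψ'` appears twisted
by conjugation by `t 0` (`card_pow_mul_evenPow`). If `N` is central the twist is trivial on `N`, and
the same argument applies. -/

namespace SubgroupDepth

open scoped MonoidAlgebra

/-! ### Completeness of the irreducible characters -/

section Completeness

variable {G : Type*} [Group G]

/-- Every simple finite-dimensional `ℂ[G]`-module affords an irreducible character. -/
theorem exists_irr_eq_trace (M : Type*) [AddCommGroup M] [Module ℂ M] [Module ℂ[G] M]
    [IsScalarTower ℂ ℂ[G] M] [FiniteDimensional ℂ M] [IsSimpleModule ℂ[G] M] :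
    ∃ χ : Irr G, ∀ g, χ.1 g =
      LinearMap.trace ℂ M (Algebra.lsmul ℂ ℂ M (MonoidAlgebra.of ℂ G g)) := by
  let e : M ≃ₗ[ℂ] (Fin (Module.finrank ℂ M) → ℂ) := (Module.finBasis ℂ M).equivFun
  let ρ : Representation ℂ G (Fin (Module.finrank ℂ M) → ℂ) :=
    { toFun := fun g => e.conj (Algebra.lsmul ℂ ℂ M (MonoidAlgebra.of ℂ G g))
      map_one' := by
        rw [map_one, map_one]
        exact LinearEquiv.conj_id e
      map_mul' := fun a b => by
        rw [map_mul, map_mul]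
        exact LinearEquiv.conj_comp e _ _ }
  have hρ : ∀ g v, ρ g (e v) = e (MonoidAlgebra.of ℂ G g • v) := fun g v => by
    change e.conj _ (e v) = _
    rw [LinearEquiv.conj_apply_apply, e.symm_apply_apply]
    rfl
  have hz : ∀ (z : ℂ[G]) v, ρ.asAlgebraHom z (e v) = e (z • v) := fun z v => by
    induction z using MonoidAlgebra.induction_on with
    | of g => rw [Representation.asAlgebraHom_of, hρ]
    | add a b ha hb => rw [map_add, LinearMap.add_apply, ha, hb, add_smul, map_add]
    | smul c a ha => rw [map_smul, LinearMap.smul_apply, ha, smul_assoc, e.map_smul c]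
  let E : M ≃ₗ[ℂ[G]] ρ.asModule :=
    { (e.trans ρ.asModuleEquiv.symm).toAddEquiv with
      map_smul' := fun z v => (hz z v).symm }
  have : IsSimpleModule ℂ[G] ρ.asModule := IsSimpleModule.congr E.symm
  refine ⟨⟨ρ.character, _, ρ, ?_, rfl⟩, fun g => ?_⟩
  · exact (Representation.irreducible_iff_isSimpleModule_asModule ρ).2 this
  · exact LinearMap.trace_conj' _ e

/-- A class function orthogonal to all irreducible characters acts by zero on every simple
finite-dimensional module. -/
theorem smul_eq_zero_of_sum_mul_char_eq_zero [Fintype G] {f : G → ℂ}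
    (hf : ∀ x g, f (g⁻¹ * x * g) = f x) (h : ∀ χ : Irr G, ∑ g, f g * χ.1 g = 0)
    (M : Type*) [AddCommGroup M] [Module ℂ M] [Module ℂ[G] M]
    [IsScalarTower ℂ ℂ[G] M] [FiniteDimensional ℂ M] [IsSimpleModule ℂ[G] M] (v : M) :
    (∑ g, f g • MonoidAlgebra.of ℂ G g) • v = 0 := by
  set z : ℂ[G] := ∑ g, f g • MonoidAlgebra.of ℂ G g with hz
  -- `z` is central because `f` is a class function; by Schur it acts as a scalar, whose trace is
  -- zero by `h`.
  have hcomm : ∀ a : ℂ[G], z * a = a * z := fun a => by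
    induction a using MonoidAlgebra.induction_on with
    | of x =>
      rw [hz, Finset.sum_mul, Finset.mul_sum]
      refine Fintype.sum_equiv (MulAut.conj x⁻¹).toEquiv _ _ fun g => ?_
      have h1 : (MulAut.conj x⁻¹).toEquiv g = x⁻¹ * g * x := by simp
      rw [h1, hf, smul_mul_assoc, mul_smul_comm, ← map_mul, ← map_mul]
      congr 2
      group
    | add a b ha hb => rw [mul_add, add_mul, ha, hb]
    | smul c a ha => rw [mul_smul_comm, smul_mul_assoc, ha]
  let T : Module.End ℂ[G] M :=
    { toFun := fun v => z • v
      map_add' := smul_add z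
      map_smul' := fun a v => by
        simp only [RingHom.id_apply]
        rw [smul_smul, smul_smul, hcomm] }
  obtain ⟨c, hc⟩ := (IsSimpleModule.algebraMap_end_bijective_of_isAlgClosed (A := ℂ[G]) (V := M) ℂ).2 T
  have hcv : ∀ v : M, z • v = c • v := fun v => by
    have := LinearMap.congr_fun hc v
    exact this.symm
  obtain ⟨χ, hχ⟩ := exists_irr_eq_trace (G := G) M
  have htr : LinearMap.trace ℂ M (Algebra.lsmul ℂ ℂ M z) = 0 := by
    rw [← h χ, hz, map_sum, map_sum]
    refine Finset.sum_congr rfl fun g _ => ?_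
    rw [map_smul, map_smul, hχ, smul_eq_mul]
  have h2 : Algebra.lsmul ℂ ℂ M z = c • LinearMap.id := LinearMap.ext hcv
  rw [h2, map_smul, LinearMap.trace_id, smul_eq_mul] at htr
  have : Nontrivial M := IsSimpleModule.nontrivial ℂ[G] M
  have hfr : (Module.finrank ℂ M : ℂ) ≠ 0 := Nat.cast_ne_zero.2 Module.finrank_pos.ne'
  rw [hcv, (mul_eq_zero.1 htr).resolve_right hfr, zero_smul]

/-- By Maschke the regular module is a sum of simple ones, so `z` kills it; then `z = z • 1 = 0`,
and the values of `f` are its coefficients. -/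
theorem eq_zero_of_sum_mul_char_eq_zero [Fintype G] {f : G → ℂ}
    (hf : ∀ x g, f (g⁻¹ * x * g) = f x) (h : ∀ χ : Irr G, ∑ g, f g * χ.1 g = 0) (x : G) :
    f x = 0 := by
  classical
  have hc : (Nat.card G : ℂ) ≠ 0 := Nat.cast_ne_zero.2 Nat.card_pos.ne'
  have : NeZero (Nat.card G : ℂ) := ⟨hc⟩
  set z : ℂ[G] := ∑ g, f g • MonoidAlgebra.of ℂ G g with hz
  have hann : ∀ v : ℂ[G], z • v = 0 := fun v => by
    have hv : v ∈ (⊤ : Submodule ℂ[G] ℂ[G]) := trivial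
    rw [← IsSemisimpleModule.sSup_simples_eq_top, sSup_eq_iSup'] at hv
    induction hv using Submodule.iSup_induction' with
    | mem S w hw =>
      have : IsSimpleModule ℂ[G] S.1 := S.2
      have hfin : FiniteDimensional ℂ ℂ[G] := inferInstance
      have : FiniteDimensional ℂ S.1 :=
        FiniteDimensional.finiteDimensional_submodule (S.1.restrictScalars ℂ)
      have := smul_eq_zero_of_sum_mul_char_eq_zero hf h S.1 ⟨w, hw⟩
      exact congrArg Subtype.val this
    | zero => exact smul_zero z
    | add a b _ _ ha hb => rw [smul_add, ha, hb, add_zero]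
  have h1 : z = 0 := by simpa using hann 1
  have h2 := congrArg (fun a : ℂ[G] => a.coeff x) h1
  simpa [hz, MonoidAlgebra.of_apply, Finsupp.single_apply] using h2

end Completeness

noncomputable section

/-! ### Expansion of class functions -/

section ClassFunctions

variable {G : Type*} [Group G]

theorem Irr.apply_conj (χ : Irr G) (x g : G) : χ.1 (g⁻¹ * x * g) = χ.1 x := by
  rw [← χ.character_rep]
  simpa using χ.rep.char_conj x g⁻¹

theorem Irr.inv_card_mul_sum_mul_self [Fintype G] (χ : Irr G) :
    (Nat.card G : ℂ)⁻¹ * ∑ g : G, χ.1 g * χ.1 g⁻¹ = 1 := by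
  have hc : (Nat.card G : ℂ) ≠ 0 := Nat.cast_ne_zero.2 Nat.card_pos.ne'
  let _ : Invertible (Nat.card G : ℂ) := invertibleOfNonzero hc
  have := χ.rep_isIrreducible
  have h1 := Representation.char_orthonormal χ.rep χ.rep
  rwa [if_pos ⟨Representation.Equiv.refl _⟩, Irr.character_rep] at h1

/-- The expansion of a class function in irreducible characters. -/
theorem eq_sum_irr [Fintype G] {f : G → ℂ} (hf : ∀ x g, f (g⁻¹ * x * g) = f x) (x : G) :
    f x = ∑ χ : Irr G, ((Nat.card G : ℂ)⁻¹ * ∑ g, f g * χ.1 g⁻¹) * χ.1 x := by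
  set c : Irr G → ℂ := fun χ => (Nat.card G : ℂ)⁻¹ * ∑ g, f g * χ.1 g⁻¹ with hc
  have h0 : (Nat.card G : ℂ) ≠ 0 := Nat.cast_ne_zero.2 Nat.card_pos.ne'
  -- The inversion of `y` matches the pairing with `χ g` there to the pairing with `χ g⁻¹` in `c`.
  have key := eq_zero_of_sum_mul_char_eq_zero
    (f := fun y => f y⁻¹ - ∑ χ : Irr G, c χ * χ.1 y⁻¹) (fun y g => ?_) (fun ψ => ?_) x⁻¹
  · simp only [inv_inv, sub_eq_zero] at key
    exact key
  · have h1 : (g⁻¹ * y * g)⁻¹ = g⁻¹ * y⁻¹ * g := by group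
    simp only [h1, hf, Irr.apply_conj]
  · rw [← Equiv.sum_comp (Equiv.inv G)]
    simp only [Equiv.inv_apply, inv_inv, sub_mul, Finset.sum_sub_distrib, Finset.sum_mul]
    rw [Finset.sum_comm, Finset.sum_eq_single ψ]
    · simp only [mul_assoc]
      rw [← Finset.mul_sum]
      have h2 := ψ.inv_card_mul_sum_mul_self
      rw [hc]
      simp only
      rw [mul_right_comm, h2, one_mul, sub_self]
    · intro χ _ hne
      simp only [mul_assoc]
      rw [← Finset.mul_sum, Irr.sum_mul_eq_zero hne, mul_zero]
    · simp

end ClassFunctions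

/-! ### Restriction, induction and powers of the inclusion matrix -/

section Restriction

variable {G : Type*} [Group G] (H : Subgroup G)

open Classical in
/-- The extension by zero to `G` of a function on `H`. -/
def extendZero (f : H → ℂ) (g : G) : ℂ := if h : g ∈ H then f ⟨g, h⟩ else 0

variable [Fintype G]

/-- Summing a product with an extension by zero. -/
theorem sum_extendZero_mul [Fintype H] (f : H → ℂ) (u : G → ℂ) :
    ∑ g, extendZero H f g * u g = ∑ h : H, f h * u h := by
  classical
  rw [← Finset.sum_subset (Finset.subset_univ (Finset.univ.filter (· ∈ H)))]
  · rw [Finset.sum_subtype (p := (· ∈ H)) _ (by simp)]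
    refine Finset.sum_congr rfl fun h _ => ?_
    rw [extendZero, dif_pos h.2]
  · intro g _ hg
    rw [extendZero, dif_neg (by simpa using hg), zero_mul]

/-- The character of `G` induced by a class function on `H`. -/
def induced (f : H → ℂ) (x : G) : ℂ :=
  (Nat.card H : ℂ)⁻¹ * ∑ g : G, extendZero H f (g⁻¹ * x * g)

/-- The permutation character of `G` on the cosets of `H`. -/
def permChar (x : G) : ℂ := induced H 1 x

theorem res_eq_sum (χ : Irr G) (h : H) :
    χ.1 h = ∑ ψ : Irr H, (inclusionMatrix H ψ χ : ℂ) * ψ.1 h := by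
  have := Fintype.ofFinite H
  rw [eq_sum_irr (f := fun h : H => χ.1 h) (fun x g => χ.apply_conj x g) h]
  simp_rw [inclusionMatrix_eq]

/-- Frobenius reciprocity: the same matrix describes restriction along columns and induction along
rows. -/
theorem induced_eq_sum (ψ : Irr H) (x : G) :
    induced H ψ.1 x = ∑ χ : Irr G, (inclusionMatrix H ψ χ : ℂ) * χ.1 x := by
  have := Fintype.ofFinite H
  have h0 : (Nat.card G : ℂ) ≠ 0 := Nat.cast_ne_zero.2 Nat.card_pos.ne'
  rw [eq_sum_irr (f := induced H ψ.1) (fun x g => ?_) x]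
  · refine Finset.sum_congr rfl fun χ _ => ?_
    congr 1
    rw [inclusionMatrix_eq]
    simp only [induced, mul_assoc (Nat.card H : ℂ)⁻¹, Finset.sum_mul]
    rw [← Finset.mul_sum, Finset.sum_comm]
    -- All conjugators `g` contribute equally, which cancels the factor `|G|⁻¹`.
    have h1 : ∀ g : G, ∑ y, extendZero H ψ.1 (g⁻¹ * y * g) * χ.1 y⁻¹ =
        ∑ h : H, χ.1 h * ψ.1 h⁻¹ := fun g => by
      rw [← Equiv.sum_comp (MulAut.conj g).toEquiv]
      have h2 : ∀ y, (MulAut.conj g).toEquiv y = g * y * g⁻¹ := fun y => by simp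
      have h3 : ∀ y, g⁻¹ * (g * y * g⁻¹) * g = y := fun y => by group
      have h4 : ∀ y, χ.1 (g * y * g⁻¹)⁻¹ = χ.1 y⁻¹ := fun y => by
        rw [← χ.apply_conj _ g]
        group
      simp only [h2, h3, h4]
      rw [sum_extendZero_mul H ψ.1 fun y => χ.1 y⁻¹, ← Equiv.sum_comp (Equiv.inv H)]
      refine Finset.sum_congr rfl fun h _ => ?_
      simp [mul_comm]
    rw [Finset.sum_congr rfl fun g _ => h1 g]
    simp only [Finset.sum_const, Finset.card_univ, nsmul_eq_mul, ← Nat.card_eq_fintype_card]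
    field_simp
  · simp only [induced]
    congr 1
    rw [← Equiv.sum_comp (Equiv.mulLeft g⁻¹)]
    refine Finset.sum_congr rfl fun y _ => ?_
    congr 1
    simp only [Equiv.coe_mulLeft]
    group

/-- Restriction followed by induction multiplies characters by the permutation character. -/
theorem sum_inclusionMatrix_mul_char (χ : Irr G) (x : G) :
    ∑ χ' : Irr G, (∑ ψ : Irr H, (inclusionMatrix H ψ χ' : ℂ) * inclusionMatrix H ψ χ) * χ'.1 x =
      χ.1 x * permChar H x := by
  have h1 : ∀ y, extendZero H (fun h => χ.1 h) y =
      ∑ ψ : Irr H, (inclusionMatrix H ψ χ : ℂ) * extendZero H ψ.1 y := fun y => by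
    unfold extendZero
    split_ifs with hy
    · exact res_eq_sum H χ ⟨y, hy⟩
    · simp
  calc _ = ∑ ψ : Irr H, (inclusionMatrix H ψ χ : ℂ) * induced H ψ.1 x := by
        simp_rw [induced_eq_sum, Finset.sum_mul, Finset.mul_sum]
        rw [Finset.sum_comm]
        refine Finset.sum_congr rfl fun ψ _ => Finset.sum_congr rfl fun χ' _ => ?_
        ring
    _ = induced H (fun h => χ.1 h) x := by
        simp only [induced, h1]
        rw [Finset.sum_comm, Finset.mul_sum]
        refine Finset.sum_congr rfl fun ψ _ => ?_
        rw [← Finset.mul_sum, mul_left_comm]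
    _ = _ := by
        simp only [permChar, induced]
        rw [mul_left_comm]
        refine congrArg _ ?_
        rw [Finset.mul_sum]
        refine Finset.sum_congr rfl fun g _ => ?_
        unfold extendZero
        split_ifs
        · change χ.1 (g⁻¹ * x * g) = χ.1 x * 1
          rw [χ.apply_conj, mul_one]
        · simp

theorem oddPow_inclusionMatrix [Fintype H] (k : ℕ) (ψ : Irr H) (χ : Irr G) :
    (oddPow (inclusionMatrix H) k ψ χ : ℂ) =
      (Nat.card H : ℂ)⁻¹ * ∑ h : H, ψ.1 h⁻¹ * χ.1 h * permChar H h ^ k := by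
  induction k generalizing χ with
  | zero =>
    rw [oddPow, pow_zero, Matrix.one_mul, inclusionMatrix_eq]
    simp only [pow_zero, mul_one, mul_comm (ψ.1 _)]
  | succ k ih =>
    set M := inclusionMatrix H with hM
    have h1 : oddPow M (k + 1) ψ χ = ∑ χ', oddPow M k ψ χ' * ∑ ψ', M ψ' χ' * M ψ' χ := by
      -- Regrouped so that the new factor `Mᵀ * M` is multiplication by `permChar`.
      have : oddPow M (k + 1) = oddPow M k * (M.transpose * M) := by
        simp only [oddPow, pow_succ, Matrix.mul_assoc]
      rw [this]
      rfl
    rw [h1]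
    push_cast
    simp_rw [ih, mul_assoc]
    rw [← Finset.mul_sum]
    congr 1
    simp_rw [Finset.sum_mul]
    rw [Finset.sum_comm]
    refine Finset.sum_congr rfl fun h _ => ?_
    have h2 := sum_inclusionMatrix_mul_char H χ (h : G)
    rw [pow_succ', ← mul_assoc (χ.1 _), ← h2, Finset.sum_mul, Finset.mul_sum]
    refine Finset.sum_congr rfl fun χ' _ => ?_
    rw [hM]
    ring

theorem evenPow_succ_inclusionMatrix [Fintype H] (k : ℕ) (ψ ψ' : Irr H) :
    (evenPow (inclusionMatrix H) (k + 1) ψ ψ' : ℂ) =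
      (Nat.card H : ℂ)⁻¹ * ∑ h : H, ψ.1 h⁻¹ * induced H ψ'.1 h * permChar H h ^ k := by
  set M := inclusionMatrix H with hM
  have h1 : evenPow M (k + 1) ψ ψ' = ∑ χ, oddPow M k ψ χ * M ψ' χ := by
    have : evenPow M (k + 1) = oddPow M k * M.transpose := by
      simp only [evenPow, oddPow, pow_succ, Matrix.mul_assoc]
    rw [this]
    rfl
  rw [h1]
  push_cast
  simp_rw [hM, oddPow_inclusionMatrix, induced_eq_sum, mul_assoc]
  rw [← Finset.mul_sum]
  congr 1
  simp_rw [Finset.sum_mul, Finset.mul_sum]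
  rw [Finset.sum_comm]
  refine Finset.sum_congr rfl fun h _ => Finset.sum_congr rfl fun χ' _ => ?_
  ring

end Restriction


/-! ### Hom spaces along group homomorphisms -/

section HomDim

variable {J K A B : Type*} [Group J] [Group K] [Group A] [Group B]

/-- The dimension of the space of `K`-homomorphisms between the pullbacks to `K` of
representations affording `ψ` and `χ`. -/
def homDim (a : K →* A) (b : K →* B) (ψ : Irr A) (χ : Irr B) : ℕ :=
  Module.finrank ℂ (Representation.IntertwiningMap (ψ.rep.comp a) (χ.rep.comp b))

theorem card_mul_homDim [Fintype K] (a : K →* A) (b : K →* B) (ψ : Irr A) (χ : Irr B) :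
    (Nat.card K : ℂ) * homDim a b ψ χ = ∑ x : K, ψ.1 (a x)⁻¹ * χ.1 (b x) := by
  have hc : (Nat.card K : ℂ) ≠ 0 := Nat.cast_ne_zero.2 Nat.card_pos.ne'
  let _ : Invertible (Nat.card K : ℂ) := invertibleOfNonzero hc
  have h1 := Representation.card_inv_mul_sum_char_mul_char_eq_finrank
    (G := K) (ψ.rep.comp a) (χ.rep.comp b)
  rw [homDim, ← h1, mul_inv_cancel_left₀ hc, ← Irr.character_rep χ, ← Irr.character_rep ψ]
  refine Finset.sum_congr rfl fun x _ => ?_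
  rw [mul_comm, ← map_inv]
  rfl

/-- A `K`-equivariant map is also `J`-equivariant: Hom spaces only grow under restriction. -/
theorem homDim_le_comp (i : J →* K) (a : K →* A) (b : K →* B) (ψ : Irr A) (χ : Irr B) :
    homDim a b ψ χ ≤ homDim (a.comp i) (b.comp i) ψ χ := by
  let F : Representation.IntertwiningMap (ψ.rep.comp a) (χ.rep.comp b) →ₗ[ℂ]
      Representation.IntertwiningMap (ψ.rep.comp (a.comp i)) (χ.rep.comp (b.comp i)) :=
    { toFun := fun f => ⟨f.toLinearMap, fun j => f.isIntertwining' (i j)⟩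
      map_add' := fun _ _ => rfl
      map_smul' := fun _ _ => rfl }
  refine LinearMap.finrank_le_finrank_of_injective (f := F) fun f g h => ?_
  exact Representation.IntertwiningMap.ext (congrArg (fun f => f.toLinearMap) h)

theorem eq_of_homDim_id_ne_zero [Finite A] {ψ ψ' : Irr A}
    (h : homDim (MonoidHom.id A) (MonoidHom.id A) ψ ψ' ≠ 0) : ψ = ψ' := by
  have := Fintype.ofFinite A
  by_contra hne
  have h1 := card_mul_homDim (MonoidHom.id A) (MonoidHom.id A) ψ ψ'
  simp only [MonoidHom.id_apply, mul_comm (ψ.1 _)] at h1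
  rw [Irr.sum_mul_eq_zero (Ne.symm hne), mul_eq_zero, Nat.cast_eq_zero, Nat.cast_eq_zero] at h1
  exact h1.elim Nat.card_pos.ne' h

end HomDim

/-! ### Intersections of conjugates and entries of the powers -/

section Tuples

variable {G : Type*} [Group G] (H : Subgroup G) {ι : Type*}

/-- The intersection of `H` with the conjugates `t i * H * (t i)⁻¹`, as a subgroup of `H`. -/
def conjInter (t : ι → G) : Subgroup H where
  carrier := {h | ∀ i, (t i)⁻¹ * h * t i ∈ H}
  one_mem' := fun i => by simp
  mul_mem' := fun {a b} ha hb i => by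
    have := H.mul_mem (ha i) (hb i)
    convert this using 1
    push_cast
    group
  inv_mem' := fun {a} ha i => by
    have := H.inv_mem (ha i)
    convert this using 1
    push_cast
    group

theorem mem_conjInter {t : ι → G} {h : H} :
    h ∈ conjInter H t ↔ ∀ i, (t i)⁻¹ * h * t i ∈ H := Iff.rfl

/-- Conjugation by `(t i)⁻¹`, from the intersection of `H` with the conjugates to `H`. -/
def conjHom (t : ι → G) (i : ι) : conjInter H t →* H where
  toFun h := ⟨(t i)⁻¹ * h * t i, h.2 i⟩
  map_one' := Subtype.ext (by simp)
  map_mul' a b := Subtype.ext (by push_cast; group)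

theorem normalCore_subgroupOf_le_conjInter (t : ι → G) :
    H.normalCore.subgroupOf H ≤ conjInter H t := fun h hh i => by
  have := (Subgroup.mem_subgroupOf.1 hh) (t i)⁻¹
  rwa [inv_inv] at this

open Classical in
theorem sum_subgroup {K : Type*} [Group K] [Fintype K] (L : Subgroup K) (u : L → ℂ) :
    ∑ x : K, (if h : x ∈ L then u ⟨x, h⟩ else 0) = ∑ x : L, u x := by
  have := sum_extendZero_mul L u 1
  simpa [extendZero] using this

/-- If the core is the intersection of `k + 1` conjugates of `H`, then it is the intersection of
`H` with `k` of its conjugates. -/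
theorem conjInter_le_normalCore {k : ℕ} {x : Fin (k + 1) → G}
    (hx : H.normalCore = ⨅ i, H.map (MulAut.conj (x i)).toMonoidHom) :
    conjInter H (fun i : Fin k => (x 0)⁻¹ * x i.succ) ≤ H.normalCore.subgroupOf H := by
  intro h hh
  rw [Subgroup.mem_subgroupOf]
  -- Conjugation by `x 0` recovers the given intersection; normality of the core undoes it.
  have h1 : x 0 * h * (x 0)⁻¹ ∈ H.normalCore := by
    rw [hx, Subgroup.mem_iInf]
    refine Fin.cases ⟨h, h.2, rfl⟩ fun i => ?_
    refine ⟨_, hh i, ?_⟩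
    simp only [MulEquiv.coe_toMonoidHom, MulAut.conj_apply]
    group
  have h2 := (inferInstance : H.normalCore.Normal).conj_mem _ h1 (x 0)⁻¹
  convert h2 using 1
  group

variable [Fintype G]

open Classical in
theorem permChar_eq (x : G) :
    permChar H x = (Nat.card H : ℂ)⁻¹ * ∑ g : G, if g⁻¹ * x * g ∈ H then 1 else 0 := by
  simp only [permChar, induced, extendZero]
  rfl

open Classical in
theorem permChar_pow (k : ℕ) (x : G) :
    permChar H x ^ k = ((Nat.card H : ℂ) ^ k)⁻¹ *
      ∑ t : Fin k → G, if ∀ i, (t i)⁻¹ * x * t i ∈ H then 1 else 0 := by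
  rw [permChar_eq, mul_pow, inv_pow, Finset.sum_pow']
  simp [Fintype.prod_ite_zero]

theorem card_pow_mul_oddPow (k : ℕ) (ψ : Irr H) (χ : Irr G) :
    Nat.card H ^ (k + 1) * oddPow (inclusionMatrix H) k ψ χ =
      ∑ t : Fin k → G, Nat.card (conjInter H t) *
        homDim (conjInter H t).subtype (H.subtype.comp (conjInter H t).subtype) ψ χ := by
  classical
  have := Fintype.ofFinite H
  have hc : (Nat.card H : ℂ) ≠ 0 := Nat.cast_ne_zero.2 Nat.card_pos.ne'
  rw [← Nat.cast_inj (R := ℂ)]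
  push_cast
  have h1 : ∀ h : H, (Nat.card H : ℂ) ^ k * (ψ.1 h⁻¹ * χ.1 h * permChar H h ^ k) =
      ∑ t : Fin k → G, if h ∈ conjInter H t then ψ.1 h⁻¹ * χ.1 h else 0 := fun h => by
    rw [permChar_pow, mul_left_comm (ψ.1 h⁻¹ * χ.1 h), mul_inv_cancel_left₀ (pow_ne_zero k hc),
      Finset.mul_sum]
    refine Finset.sum_congr rfl fun t _ => ?_
    rw [mul_ite, mul_one, mul_zero]
    exact if_congr Iff.rfl rfl rfl
  rw [oddPow_inclusionMatrix, pow_succ, mul_assoc, mul_inv_cancel_left₀ hc, Finset.mul_sum,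
    Finset.sum_congr rfl fun h _ => h1 h, Finset.sum_comm]
  refine Finset.sum_congr rfl fun t _ => ?_
  rw [card_mul_homDim, ← sum_subgroup]
  refine Finset.sum_congr rfl fun h _ => ?_
  by_cases hh : h ∈ conjInter H t
  · rw [dif_pos hh, if_pos hh]
    rfl
  · rw [dif_neg hh, if_neg hh]

theorem card_pow_mul_evenPow (k : ℕ) (ψ ψ' : Irr H) :
    Nat.card H ^ (k + 2) * evenPow (inclusionMatrix H) (k + 1) ψ ψ' =
      ∑ t : Fin (k + 1) → G, Nat.card (conjInter H t) *
        homDim (conjInter H t).subtype (conjHom H t 0) ψ ψ' := by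
  classical
  have := Fintype.ofFinite H
  have hc : (Nat.card H : ℂ) ≠ 0 := Nat.cast_ne_zero.2 Nat.card_pos.ne'
  rw [← Nat.cast_inj (R := ℂ)]
  push_cast
  have h1 : ∀ h : H, induced H ψ'.1 h * permChar H h ^ k = ((Nat.card H : ℂ) ^ (k + 1))⁻¹ *
      ∑ t : Fin (k + 1) → G, if hh : h ∈ conjInter H t then ψ'.1 (conjHom H t 0 ⟨h, hh⟩) else 0 := by
    intro h
    -- Coordinate `0` of the tuple is the conjugator of the induced character; the other `k` come
    -- from `permChar ^ k`.
    rw [permChar_pow, induced, mul_mul_mul_comm, ← mul_inv, ← pow_succ', Finset.sum_mul_sum,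
      ← Fintype.sum_prod_type', ← Equiv.sum_comp (Fin.consEquiv fun _ : Fin (k + 1) => G)]
    refine congrArg _ (Finset.sum_congr rfl fun p _ => ?_)
    have h2 : h ∈ conjInter H (Fin.consEquiv (fun _ : Fin (k + 1) => G) p) ↔
        p.1⁻¹ * h * p.1 ∈ H ∧ ∀ i, (p.2 i)⁻¹ * h * p.2 i ∈ H := by
      rw [mem_conjInter, Fin.forall_fin_succ]
      rfl
    by_cases h3 : p.1⁻¹ * h * p.1 ∈ H
    · by_cases h4 : ∀ i, (p.2 i)⁻¹ * h * p.2 i ∈ H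
      · rw [dif_pos (h2.2 ⟨h3, h4⟩), if_pos h4, extendZero, dif_pos h3, mul_one]
        rfl
      · rw [dif_neg fun h5 => h4 (h2.1 h5).2, if_neg h4, mul_zero]
    · rw [dif_neg fun h5 => h3 (h2.1 h5).1, extendZero, dif_neg h3, zero_mul]
  have h2 : ∀ h : H, (Nat.card H : ℂ) ^ (k + 1) *
      (ψ.1 h⁻¹ * induced H ψ'.1 h * permChar H h ^ k) = ∑ t : Fin (k + 1) → G,
        if hh : h ∈ conjInter H t then ψ.1 h⁻¹ * ψ'.1 (conjHom H t 0 ⟨h, hh⟩) else 0 := fun h => by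
    rw [mul_assoc (ψ.1 h⁻¹), h1, mul_left_comm (ψ.1 h⁻¹),
      mul_inv_cancel_left₀ (pow_ne_zero (k + 1) hc), Finset.mul_sum]
    refine Finset.sum_congr rfl fun t _ => ?_
    by_cases hh : h ∈ conjInter H t
    · rw [dif_pos hh, dif_pos hh]
    · rw [dif_neg hh, dif_neg hh, mul_zero]
  rw [evenPow_succ_inclusionMatrix, pow_succ _ (k + 1), mul_assoc, mul_inv_cancel_left₀ hc,
    Finset.mul_sum, Finset.sum_congr rfl fun h _ => h2 h, Finset.sum_comm]
  refine Finset.sum_congr rfl fun t _ => ?_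
  rw [card_mul_homDim, ← sum_subgroup]
  rfl

/-- No cancellation: the summands are natural numbers with weights `|H_t| > 0`. -/
theorem oddPow_ne_zero_iff (k : ℕ) (ψ : Irr H) (χ : Irr G) :
    oddPow (inclusionMatrix H) k ψ χ ≠ 0 ↔ ∃ t : Fin k → G,
      homDim (conjInter H t).subtype (H.subtype.comp (conjInter H t).subtype) ψ χ ≠ 0 := by
  have h := card_pow_mul_oddPow H k ψ χ
  have hc : Nat.card H ^ (k + 1) ≠ 0 := pow_ne_zero _ Nat.card_pos.ne'
  have h0 : oddPow (inclusionMatrix H) k ψ χ = 0 ↔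
      Nat.card H ^ (k + 1) * oddPow (inclusionMatrix H) k ψ χ = 0 :=
    ⟨fun h => by rw [h, mul_zero], fun h => (mul_eq_zero.1 h).resolve_left hc⟩
  rw [← not_iff_not, not_not, h0, h, Finset.sum_eq_zero_iff]
  simp [Nat.card_pos.ne']

theorem evenPow_succ_ne_zero_iff (k : ℕ) (ψ ψ' : Irr H) :
    evenPow (inclusionMatrix H) (k + 1) ψ ψ' ≠ 0 ↔ ∃ t : Fin (k + 1) → G,
      homDim (conjInter H t).subtype (conjHom H t 0) ψ ψ' ≠ 0 := by
  have h := card_pow_mul_evenPow H k ψ ψ'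
  have hc : Nat.card H ^ (k + 2) ≠ 0 := pow_ne_zero _ Nat.card_pos.ne'
  have h0 : evenPow (inclusionMatrix H) (k + 1) ψ ψ' = 0 ↔
      Nat.card H ^ (k + 2) * evenPow (inclusionMatrix H) (k + 1) ψ ψ' = 0 :=
    ⟨fun h => by rw [h, mul_zero], fun h => (mul_eq_zero.1 h).resolve_left hc⟩
  rw [← not_iff_not, not_not, h0, h, Finset.sum_eq_zero_iff]
  simp [Nat.card_pos.ne']

end Tuples

/-! ### Supports of the powers in terms of the core -/

section Support

variable {G : Type*} [Group G] [Finite G] (H : Subgroup G)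

theorem homDim_core_of_oddPow_ne_zero {k : ℕ} {ψ : Irr H} {χ : Irr G}
    (h : oddPow (inclusionMatrix H) k ψ χ ≠ 0) :
    homDim (H.normalCore.subgroupOf H).subtype
      (H.subtype.comp (H.normalCore.subgroupOf H).subtype) ψ χ ≠ 0 := by
  have := Fintype.ofFinite G
  obtain ⟨t, ht⟩ := (oddPow_ne_zero_iff H k ψ χ).1 h
  refine fun h0 => ht (Nat.le_zero.1 (h0 ▸ ?_))
  exact homDim_le_comp (Subgroup.inclusion (normalCore_subgroupOf_le_conjInter H t)) _ _ ψ χ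

theorem oddPow_ne_zero_of_homDim_core {k : ℕ} {t : Fin k → G}
    (ht : conjInter H t ≤ H.normalCore.subgroupOf H) {ψ : Irr H} {χ : Irr G}
    (h : homDim (H.normalCore.subgroupOf H).subtype
      (H.subtype.comp (H.normalCore.subgroupOf H).subtype) ψ χ ≠ 0) :
    oddPow (inclusionMatrix H) k ψ χ ≠ 0 := by
  have := Fintype.ofFinite G
  refine (oddPow_ne_zero_iff H k ψ χ).2 ⟨t, fun h0 => h (Nat.le_zero.1 (h0 ▸ ?_))⟩
  exact homDim_le_comp (Subgroup.inclusion ht) _ _ ψ χ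

theorem homDim_core_of_evenPow_ne_zero (hZ : H.normalCore ≤ Subgroup.center G) {k : ℕ}
    {ψ ψ' : Irr H} (h : evenPow (inclusionMatrix H) (k + 1) ψ ψ' ≠ 0) :
    homDim (H.normalCore.subgroupOf H).subtype (H.normalCore.subgroupOf H).subtype ψ ψ' ≠ 0 := by
  have := Fintype.ofFinite G
  obtain ⟨t, ht⟩ := (evenPow_succ_ne_zero_iff H k ψ ψ').1 h
  have h1 := homDim_le_comp
    (Subgroup.inclusion (normalCore_subgroupOf_le_conjInter H t))
    (conjInter H t).subtype (conjHom H t 0) ψ ψ'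
  have h2 : (conjHom H t 0).comp
      (Subgroup.inclusion (normalCore_subgroupOf_le_conjInter H t)) =
        (H.normalCore.subgroupOf H).subtype := by
    ext x
    have hx := Subgroup.mem_center_iff.1 (hZ (Subgroup.mem_subgroupOf.1 x.2)) (t 0)⁻¹
    change (t 0)⁻¹ * ((x : H) : G) * t 0 = ((x : H) : G)
    rw [hx, inv_mul_cancel_right]
  rw [h2] at h1
  exact fun h0 => ht (Nat.le_zero.1 (h1.trans_eq h0))

theorem evenPow_ne_zero_of_homDim_core (hZ : H.normalCore ≤ Subgroup.center G) {k : ℕ}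
    {t : Fin (k + 1) → G} (ht : conjInter H t ≤ H.normalCore.subgroupOf H) {ψ ψ' : Irr H}
    (h : homDim (H.normalCore.subgroupOf H).subtype
      (H.normalCore.subgroupOf H).subtype ψ ψ' ≠ 0) :
    evenPow (inclusionMatrix H) (k + 1) ψ ψ' ≠ 0 := by
  have := Fintype.ofFinite G
  have h1 := homDim_le_comp (Subgroup.inclusion ht) (H.normalCore.subgroupOf H).subtype
    (H.normalCore.subgroupOf H).subtype ψ ψ'
  have h2 : conjHom H t 0 =
      (H.normalCore.subgroupOf H).subtype.comp (Subgroup.inclusion ht) := by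
    ext x
    have hx := Subgroup.mem_center_iff.1 (hZ (Subgroup.mem_subgroupOf.1 (ht x.2))) (t 0)⁻¹
    change (t 0)⁻¹ * ((x : H) : G) * t 0 = ((x : H) : G)
    rw [hx, inv_mul_cancel_right]
  refine (evenPow_succ_ne_zero_iff H k ψ ψ').2 ⟨t, fun h0 => h (Nat.le_zero.1 ?_)⟩
  rw [h2] at h0
  exact h1.trans_eq h0

end Support

/-! ### From supports to depth -/

section Depth

variable {r s : Type*} [Fintype r] [Fintype s]

theorem exists_le_mul_of_support {A B : Matrix r s ℕ} (h : ∀ i j, A i j ≠ 0 → B i j ≠ 0) :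
    ∃ q : ℕ, 0 < q ∧ ∀ i j, A i j ≤ q * B i j := by
  -- The `1` keeps `q` positive when `A = 0`.
  refine ⟨1 + ∑ i, ∑ j, A i j, by omega, fun i j => ?_⟩
  by_cases h0 : A i j = 0
  · rw [h0]
    exact Nat.zero_le _
  · have h1 : A i j ≤ ∑ j, A i j :=
      Finset.single_le_sum (f := A i) (fun _ _ => Nat.zero_le _) (Finset.mem_univ j)
    have h2 : ∑ j, A i j ≤ ∑ i, ∑ j, A i j :=
      Finset.single_le_sum (f := fun i => ∑ j, A i j) (fun _ _ => Nat.zero_le _)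
        (Finset.mem_univ i)
    have h3 := Nat.pos_of_ne_zero (h i j h0)
    calc A i j ≤ 1 + ∑ i, ∑ j, A i j := by omega
      _ ≤ _ := Nat.le_mul_of_pos_right _ h3

theorem matrixDepth_le [DecidableEq r] {M : Matrix r s ℕ} {n : ℕ} (h : DepthInequality M n) :
    matrixDepth M ≤ n :=
  iInf_le (fun n : {n : ℕ // DepthInequality M n} => (n.1 : ℕ∞)) ⟨n, h⟩

end Depth

end

end SubgroupDepth

theorem mainTheorem4 {G : Type*} [Group G] [Finite G] (H : Subgroup G) (m : ℕ) (hm : 1 ≤ m)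
    (x : Fin m → G)
    (hcore : H.normalCore = ⨅ i, H.map (MulAut.conj (x i)).toMonoidHom) :
    SubgroupDepth.subgroupDepth H ≤ ((2 * m : ℕ) : ℕ∞) ∧
      (H.normalCore ≤ Subgroup.center G →
        SubgroupDepth.subgroupDepth H ≤ ((2 * m - 1 : ℕ) : ℕ∞)) := by
  -- One of the `m` conjugates can be taken to be `H` itself, leaving `k`.
  obtain ⟨k, rfl⟩ : ∃ k, m = k + 1 := ⟨m - 1, by omega⟩
  have ht := SubgroupDepth.conjInter_le_normalCore H hcore
  refine ⟨SubgroupDepth.matrixDepth_le (Or.inr ⟨k, by ring, ?_⟩), fun hZ =>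
    SubgroupDepth.matrixDepth_le (Or.inl ⟨k, by omega, ?_⟩)⟩
  · refine SubgroupDepth.exists_le_mul_of_support fun ψ χ h => ?_
    exact SubgroupDepth.oddPow_ne_zero_of_homDim_core H ht
      (SubgroupDepth.homDim_core_of_oddPow_ne_zero H h)
  · refine SubgroupDepth.exists_le_mul_of_support fun ψ ψ' h => ?_
    have h1 := SubgroupDepth.homDim_core_of_evenPow_ne_zero H hZ h
    cases k with
    | succ k => exact SubgroupDepth.evenPow_ne_zero_of_homDim_core H hZ ht h1
    | zero =>
      -- Here `M ^ 0` is the identity, not a sum over tuples. But the empty tuple gives `H = N`, so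
      -- a nonzero Hom space over `N` is one over `H`, and Schur gives `ψ = ψ'`.
      have h2 : ∀ y : H, y ∈ H.normalCore.subgroupOf H := fun y => ht fun i => i.elim0
      have h3 : ψ = ψ' := SubgroupDepth.eq_of_homDim_id_ne_zero fun h0 => h1 <|
        Nat.le_zero.1 <| h0 ▸ SubgroupDepth.homDim_le_comp
          ((MonoidHom.id H).codRestrict _ h2) _ _ ψ ψ'
      rw [h3, SubgroupDepth.evenPow, pow_zero, Matrix.one_apply_eq]
      exact one_ne_zero
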